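/- Let $p\ge 1$ and $s=2^{p-1}$. For an activation function $\tau\in C^1(\mathbb{R})$ and a polynomial $h:\mathbb{R}^p\to\mathbb{R}$, consider the flow in $\mathbb{R}^p$ $$\frac{d}{dt}\hat w(t)=\mathbb{E}_{z\sim\mathcal N(0,I_p)}\big[z\,h(z)\,\tau'(\hat w(t)^\top z)\big],\qquad \hat w(0)=0. \tag{1}$$ Say that $(\tau,h)$ satisfies condition $(\mathrm{A}_s)$ if (1) has a solution on some interval $[0,T)$, $T>0$ (the expectation existing along it), and every such solution has a Taylor expansion $\hat w(t)=\sum_{j=0}^{s}t^jq_j+o(t^s)$ as $t\to0^+$, with $q_j\in\mathbb{R}^p$, such that the curve $t\mapsto\sum_{j=0}^s t^jq_j$ is not contained in any proper linear subspace of $\mathbb{R}^p$. Let $\alpha_1,\dots,\alpha_m$ be pairwise distinct elements of $\mathbb{N}^p$ among which are $(1,0,\dots,0),(1,1,0,\dots,0),\dots,(1,1,\dots,1)$. For $c=(c_1,\dots,c_m)\in\mathbb{R}^m$ let $$h^*_c(z)=\sum_{i=1}^m c_i\prod_{j=1}^p \mathrm{He}_{\alpha_i(j)}(z_j),$$ where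 $\mathrm{He}_k$ is the $k$-th probabilists' Hermite polynomial. Let $\sigma\in C^{s}(\mathbb{R})$ with $\sigma^{(1)}(0),\dots,\sigma^{(p)}(0)$ all nonzero, and let $T_s\sigma(x)=\sum_{k=0}^s\frac{\sigma^{(k)}(0)}{k!}x^k$ be its Taylor polynomial at $0$. Then: 1. For Lebesgue-almost every $c\in\mathbb{R}^m$, $(T_s\sigma,h^*_c)$ satisfies $(\mathrm{A}_s)$. 2. If moreover $\sigma'$ has at most Gaussian growth, i.e. $|\sigma'(x)|\le Ce^{Cx^2}$ for all $x\in\mathbb{R}$ and some constant $C$ (for example, if $\sigma'$ is bounded), then for Lebesgue-almost every $c\in\mathbb{R}^m$, $(\sigma,h^*_c)$ satisfies $(\mathrm{A}_s)$. -/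

import Mathlib

open scoped RealInnerProductSpace

noncomputable section

namespace SubspaceFlow

section General

variable {V : Type*} [NormedAddCommGroup V] [InnerProductSpace ℝ V] [FiniteDimensional ℝ V]
  [MeasurableSpace V] [BorelSpace V]

/-- The random vector `z h(z) σ'(wᵀ z)` (as a function of `z`) whose expectation drives the flow. -/
def driftIntegrand (σ : ℝ → ℝ) (h : V → ℝ) (w z : V) : V :=
  (h z * deriv σ ⟪w, z⟫) • z

/-- The drift `E_z[z h(z) σ'(wᵀ z)]`, with `z` standard Gaussian on `V`. -/
def drift (σ : ℝ → ℝ) (h : V → ℝ) (w : V) : V :=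
  ∫ z, driftIntegrand σ h w z ∂(ProbabilityTheory.stdGaussian V)

/-- `w` solves `w'(t) = E_z[z h(z) σ'(w(t)ᵀ z)]`, `w(0) = 0` on the interval `[0, T)`
(the derivative at `t = 0` is the right derivative); the expectation is required to exist. -/
structure IsFlow (σ : ℝ → ℝ) (h : V → ℝ) (T : ℝ) (w : ℝ → V) : Prop where
  pos : 0 < T
  init : w 0 = 0
  integrable : ∀ t ∈ Set.Ico 0 T,
    MeasureTheory.Integrable (driftIntegrand σ h (w t)) (ProbabilityTheory.stdGaussian V)
  deriv_eq : ∀ t ∈ Set.Ico 0 T, HasDerivWithinAt w (drift σ h (w t)) (Set.Ico 0 T) t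

/-- The polynomial curve `t ↦ ∑_{j ≤ s} t^j q_j` in `V`. -/
def polyCurve (s : ℕ) (q : ℕ → V) (t : ℝ) : V :=
  ∑ j ∈ Finset.range (s + 1), t ^ j • q j

/-- `∑_{j ≤ s} t^j q_j` is the Taylor expansion up to order `s` of the curve `w` at `t = 0⁺`. -/
def HasTaylorExpansion (w : ℝ → V) (s : ℕ) (q : ℕ → V) : Prop :=
  (fun t : ℝ => w t - polyCurve s q t) =o[nhdsWithin 0 (Set.Ici 0)] (fun t : ℝ => t ^ s)

/-- The flow exists (locally in time), and its Taylor expansion at `t = 0` up to order `s` exists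
and is not contained in any proper subspace of `V`. As the field need not be Lipschitz, the flow
need not be unique a priori, and the condition is asked of every solution. -/
def NotTrapped (σ : ℝ → ℝ) (h : V → ℝ) (s : ℕ) : Prop :=
  (∃ T w, IsFlow σ h T w) ∧
  ∀ T w, IsFlow σ h T w → ∃ q : ℕ → V, HasTaylorExpansion w s q ∧
    ∀ S : Submodule ℝ V, (∀ t : ℝ, polyCurve s q t ∈ S) → S = ⊤

end General

/-- The Taylor polynomial of `σ` at `0` of degree `s`. -/
def taylorPoly (σ : ℝ → ℝ) (s : ℕ) (x : ℝ) : ℝ :=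
  ∑ k ∈ Finset.range (s + 1), iteratedDeriv k σ 0 / (Nat.factorial k : ℝ) * x ^ k

/-- `h(z) = ∑_i c_i ∏_j He_{α_i(j)}(z_j)`, with the probabilists' Hermite polynomials `He_k`. -/
def hermiteSum {m p : ℕ} (α : Fin m → Fin p → ℕ) (c : Fin m → ℝ)
    (z : EuclideanSpace ℝ (Fin p)) : ℝ :=
  ∑ i, c i * ∏ j, Polynomial.aeval (z j) (Polynomial.hermite (α i j))

end SubspaceFlow

end

/-! Replacing `σ'` by its Taylor polynomial of degree `s - 1` at `0` changes the drift by `o(‖w‖ ^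
(s - 1))` and turns it into a polynomial field whose coefficients are linear in `c`
(`isLittleO_drift_sub_polyField`). Every solution then agrees up to `o(t ^ s)` with the `s`-th
Picard iterate of that field (`isLittleO_sub_picard`), whose coefficients are polynomials in `c`.
The curve spans the space as soon as the coefficients of orders `2 ^ k`, `k < p`, are independent,
so it suffices that the polynomial `picardDet` be nonzero at one `c`; it is then nonzero almost
everywhere.

The test point keeps only the staircase products `z_0 ⋯ z_k`. Give `w_j` the weight `2 ^ j`. By
parity of Gaussian moments, component `i` of the field is a nonzero multiple of `∏_{j < i} w_j`, of
weight `2 ^ i - 1`, plus terms of weight at least `2 ^ i`. Hence `w_i` starts exactly at order `t ^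
(2 ^ i)`, and the matrix of coefficients is triangular with nonzero diagonal.

The drift is continuous near `0` but need not be Lipschitz, so existence comes from Peano's theorem.
-/

section

/-! ### Peano existence by Euler polygons. -/

open Filter Topology Metric

/-- The nodes of the explicit Euler scheme with step `τ` for the field `F`, started at `0`. -/
def eulerNode {V : Type*} [AddCommGroup V] [Module ℝ V] (F : V → V) (τ : ℝ) : ℕ → V
  | 0 => 0
  | k + 1 => eulerNode F τ k + τ • F (eulerNode F τ k)

/-- Each step contributes an error of at most `τ * ε`, and these add up. With `u = 0` this bounds
the speed of the scheme; with `u = F (w t)` it yields the derivative of the limit. -/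
theorem norm_eulerNode_sub_le {V : Type*} [NormedAddCommGroup V] [NormedSpace ℝ V] {F : V → V}
    {τ ε : ℝ} (hτ : 0 ≤ τ) (u : V) {a b : ℕ} (hab : a ≤ b)
    (h : ∀ k, a ≤ k → k < b → ‖F (eulerNode F τ k) - u‖ ≤ ε) :
    ‖eulerNode F τ b - eulerNode F τ a - (τ * (b - a : ℝ)) • u‖ ≤ τ * (b - a : ℝ) * ε := by
  induction b, hab using Nat.le_induction with
  | base => simp
  | succ b hab ih =>
    have h1 := ih fun k hk hkb => h k hk (hkb.trans b.lt_succ_self)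
    have h2 := h b hab b.lt_succ_self
    have e : eulerNode F τ (b + 1) - eulerNode F τ a - (τ * ((b + 1 : ℕ) - a : ℝ)) • u
        = (eulerNode F τ b - eulerNode F τ a - (τ * (b - a : ℝ)) • u)
          + τ • (F (eulerNode F τ b) - u) := by
      simp only [eulerNode, smul_sub, Nat.cast_add, Nat.cast_one]
      module
    rw [e]
    refine (norm_add_le _ _).trans ?_
    rw [norm_smul, Real.norm_of_nonneg hτ]
    have := mul_le_mul_of_nonneg_left h2 hτ
    push_cast
    linarith

theorem norm_eulerNode_le {V : Type*} [NormedAddCommGroup V] [NormedSpace ℝ V] {F : V → V}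
    {τ M r : ℝ} (hτ : 0 ≤ τ) (hM : 0 ≤ M) (hF : ∀ x ∈ closedBall (0 : V) r, ‖F x‖ ≤ M) (k : ℕ)
    (hk : τ * k * M ≤ r) : ‖eulerNode F τ k‖ ≤ τ * k * M := by
  induction k with
  | zero => simp [eulerNode]
  | succ k ih =>
    push_cast at hk ⊢
    have hτM := mul_nonneg hτ hM
    have h1 := ih (by nlinarith)
    have h2 : ‖F (eulerNode F τ k)‖ ≤ M := hF _ (by
      rw [mem_closedBall_zero_iff]; nlinarith)
    refine (norm_add_le _ _).trans ?_
    rw [norm_smul, Real.norm_of_nonneg hτ]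
    nlinarith [mul_le_mul_of_nonneg_left h2 hτ]

/-- **Peano's existence theorem** for autonomous equations in a finite-dimensional space. -/
theorem exists_hasDerivWithinAt_of_continuousOn {V : Type*} [NormedAddCommGroup V]
    [NormedSpace ℝ V] [FiniteDimensional ℝ V] {F : V → V} {r : ℝ} (hr : 0 < r)
    (hF : ContinuousOn F (closedBall 0 r)) :
    ∃ T > 0, ∃ w : ℝ → V, w 0 = 0 ∧ ∀ t ∈ Set.Ico 0 T, w t ∈ closedBall 0 r ∧
      HasDerivWithinAt w (F (w t)) (Set.Ico 0 T) t := by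
  have : ProperSpace V := FiniteDimensional.proper_real V
  obtain ⟨M₀, hM₀⟩ := (isCompact_closedBall (0 : V) r).exists_bound_of_continuousOn hF
  obtain ⟨M, hM0, hM⟩ : ∃ M > 0, ∀ x ∈ closedBall (0 : V) r, ‖F x‖ ≤ M :=
    ⟨max M₀ 1, by positivity, fun x hx => (hM₀ x hx).trans (le_max_left _ _)⟩
  have hT : 0 < r / M := by positivity
  set τ : ℕ → ℝ := fun n => 1 / ((n : ℝ) + 1) with hτ
  have hτ0 : ∀ n, 0 < τ n := fun n => by positivity
  -- Limits along a nonprincipal ultrafilter exist at every `t` by compactness of the ball, so no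
  -- equicontinuous subsequence has to be extracted.
  have hτlim : Tendsto τ (hyperfilter ℕ) (𝓝 0) :=
    tendsto_one_div_add_atTop_nhds_zero_nat.mono_left Nat.hyperfilter_le_atTop
  set N : ℕ → ℝ → ℕ := fun n t => ⌊((n : ℝ) + 1) * t⌋₊ with hN
  have hN_le : ∀ n t, 0 ≤ t → τ n * N n t ≤ t := fun n t ht => by
    have := Nat.floor_le (a := ((n : ℝ) + 1) * t) (by positivity)
    simp only [hτ, hN]
    rw [div_mul_eq_mul_div, one_mul, div_le_iff₀ (by positivity)]
    linarith
  have hN_ge : ∀ n t, t - τ n ≤ τ n * N n t := fun n t => by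
    have := Nat.lt_floor_add_one (((n : ℝ) + 1) * t)
    simp only [hτ, hN]
    have h0 : (0 : ℝ) < n + 1 := by positivity
    rw [div_mul_eq_mul_div, one_mul, sub_le_iff_le_add, ← add_div, le_div_iff₀ h0]
    linarith
  have hNlim : ∀ t, 0 ≤ t → Tendsto (fun n => τ n * N n t) (hyperfilter ℕ) (𝓝 t) := fun t ht =>
    tendsto_of_tendsto_of_tendsto_of_le_of_le
      (by simpa using tendsto_const_nhds (x := t) |>.sub hτlim) tendsto_const_nhds
      (fun n => hN_ge n t) (fun n => hN_le n t ht)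
  set y : ℕ → ℝ → V := fun n t => eulerNode F (τ n) (N n t) with hy
  have hmem : ∀ n (k : ℕ), τ n * k ≤ r / M → eulerNode F (τ n) k ∈ closedBall (0 : V) r := by
    intro n k hk
    have h1 : τ n * k * M ≤ r := by rwa [le_div_iff₀ hM0] at hk
    rw [mem_closedBall_zero_iff]
    exact (norm_eulerNode_le (hτ0 n).le hM0.le hM k h1).trans h1
  have hlim : ∀ t, ∃ v : V, t ∈ Set.Ico 0 (r / M) →
      v ∈ closedBall 0 r ∧ Tendsto (fun n => y n t) (hyperfilter ℕ) (𝓝 v) := by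
    intro t
    by_cases ht : t ∈ Set.Ico 0 (r / M)
    · obtain ⟨v, hv, hle⟩ := (isCompact_closedBall (0 : V) r).ultrafilter_le_nhds
        ((hyperfilter ℕ).map fun n => y n t) (by
          rw [Ultrafilter.coe_map, le_principal_iff, mem_map]
          exact Eventually.of_forall fun n =>
            hmem n _ ((hN_le n t ht.1).trans ht.2.le))
      exact ⟨v, fun _ => ⟨hv, hle⟩⟩
    · exact ⟨0, fun h => absurd h ht⟩
  choose w hw using hlim
  refine ⟨r / M, hT, w, ?_, fun t ht => ⟨(hw t ht).1, ?_⟩⟩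
  · have h0 := (hw 0 ⟨le_rfl, hT⟩).2
    have : (fun n => y n 0) = fun _ => (0 : V) := by
      funext n; simp [hy, hN, eulerNode]
    rw [this] at h0
    exact (tendsto_nhds_unique h0 tendsto_const_nhds)
  -- the difference quotients of the Euler approximations pass to the limit
  have key : ∀ ε > 0, ∃ δ > 0, ∀ a ∈ Set.Ico 0 (r / M), ∀ b ∈ Set.Ico 0 (r / M), a ≤ b →
      a = t ∨ b = t → b - a < δ → ‖w b - w a - (b - a) • F (w t)‖ ≤ (b - a) * ε := by
    intro ε hε
    obtain ⟨δ, hδ, hδF⟩ := Metric.continuousOn_iff.1 hF (w t) (hw t ht).1 ε hε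
    -- Elapsed time and rounding of the step count each cost less than `δ / (4 * M)`, so at speed
    -- `M` the nodes move less than `δ / 2`. With `δ / 4` for the distance from `y n t` to `w t`,
    -- they stay within `δ` of `w t`.
    refine ⟨δ / (4 * M), by positivity, fun a ha b hb hab hat hba => ?_⟩
    have l1 : Tendsto (fun n => ‖y n b - y n a - (τ n * N n b - τ n * N n a) • F (w t)‖)
        (hyperfilter ℕ) (𝓝 ‖w b - w a - (b - a) • F (w t)‖) :=
      ((((hw b hb).2.sub (hw a ha).2).sub
        (((hNlim b hb.1).sub (hNlim a ha.1)).smul_const _))).norm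
    have l2 : Tendsto (fun n => (τ n * N n b - τ n * N n a) * ε)
        (hyperfilter ℕ) (𝓝 ((b - a) * ε)) :=
      ((hNlim b hb.1).sub (hNlim a ha.1)).mul_const _
    refine le_of_tendsto_of_tendsto l1 l2 ?_
    have e1 : ∀ᶠ n in hyperfilter ℕ, dist (y n t) (w t) < δ / 4 :=
      (Metric.tendsto_nhds.1 (hw t ht).2) _ (by positivity)
    have e2 : ∀ᶠ n in hyperfilter ℕ, τ n < δ / (4 * M) :=
      hτlim.eventually (gt_mem_nhds (by positivity))
    filter_upwards [e1, e2] with n h1 h2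
    have hNab : N n a ≤ N n b := Nat.floor_mono (by gcongr)
    have hin : ∀ k ≤ N n b, eulerNode F (τ n) k ∈ closedBall (0 : V) r := fun k hk =>
      hmem n k (by
        have : (k : ℝ) ≤ N n b := by exact_mod_cast hk
        have := mul_le_mul_of_nonneg_left this (hτ0 n).le
        exact this.trans ((hN_le n b hb.1).trans hb.2.le))
    have hinc : ∀ k l, k ≤ l → l ≤ N n b →
        ‖eulerNode F (τ n) l - eulerNode F (τ n) k‖ ≤ τ n * (l - k : ℝ) * M := by
      intro k l hkl hl
      simpa using norm_eulerNode_sub_le (F := F) (hτ0 n).le (0 : V) hkl (ε := M)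
        (fun j _ hj => by simpa using hM _ (hin j (by omega)))
    have hlen : τ n * (N n b - N n a : ℝ) * M < δ / 2 := by
      have h3 := hN_le n b hb.1
      have h4 := hN_ge n a
      have : τ n * (N n b - N n a : ℝ) < δ / (4 * M) + δ / (4 * M) := by linarith
      calc _ < (δ / (4 * M) + δ / (4 * M)) * M := by gcongr
        _ = δ / 2 := by field_simp; norm_num
    have hclose : ∀ k, N n a ≤ k → k < N n b → ‖F (eulerNode F (τ n) k) - F (w t)‖ ≤ ε := by
      intro k hk hkb
      rw [← dist_eq_norm]
      refine (hδF _ (hin k hkb.le) ?_).le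
      have hτM : 0 ≤ τ n * M := (mul_pos (hτ0 n) hM0).le
      have hk1 : (N n a : ℝ) ≤ k := by exact_mod_cast hk
      have hk2 : (k : ℝ) ≤ N n b := by exact_mod_cast hkb.le
      have : dist (eulerNode F (τ n) k) (y n t) ≤ τ n * (N n b - N n a : ℝ) * M := by
        rcases hat with rfl | rfl
        · rw [dist_eq_norm]
          refine (hinc _ _ hk hkb.le).trans ?_
          nlinarith
        · rw [dist_comm, dist_eq_norm]
          refine (hinc _ _ hkb.le le_rfl).trans ?_
          nlinarith
      linarith [dist_triangle (eulerNode F (τ n) k) (y n t) (w t)]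
    have := norm_eulerNode_sub_le (F := F) (hτ0 n).le (F (w t)) hNab hclose
    simpa only [mul_sub] using this
  rw [hasDerivWithinAt_iff_isLittleO, Asymptotics.isLittleO_iff]
  intro ε hε
  obtain ⟨δ, hδ, hkey⟩ := key ε hε
  rw [eventually_nhdsWithin_iff]
  filter_upwards [Metric.ball_mem_nhds t hδ] with x hx hxT
  rw [Metric.mem_ball, Real.dist_eq] at hx
  rcases le_total t x with h | h
  · have := hkey t ht x hxT h (Or.inl rfl) (by rwa [abs_of_nonneg (by linarith)] at hx)
    rw [Real.norm_of_nonneg (by linarith)]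
    linarith
  · have := hkey x hxT t ht h (Or.inr rfl) (by
      rw [abs_of_nonpos (by linarith)] at hx; linarith)
    rw [Real.norm_of_nonpos (by linarith), ← norm_neg]
    calc _ = ‖w t - w x - (t - x) • F (w t)‖ := by congr 1; module
      _ ≤ _ := by linarith

end

/-! ### Comparison of solutions with Picard iterates. -/

section

open Filter Topology Metric Asymptotics

section PicardExpansion

variable {V : Type*} [NormedAddCommGroup V] [NormedSpace ℝ V]

/-- Integration of a little-o estimate at the left endpoint of an interval. -/
theorem isLittleO_pow_succ_of_hasDerivWithinAt {u u' : ℝ → V} {T : ℝ} (hT : 0 < T) {n : ℕ}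
    (hu : ∀ t ∈ Set.Ico 0 T, HasDerivWithinAt u (u' t) (Set.Ico 0 T) t) (h0 : u 0 = 0)
    (h : u' =o[𝓝[Set.Ici 0] 0] fun t : ℝ => t ^ n) :
    u =o[𝓝[Set.Ici 0] 0] fun t : ℝ => t ^ (n + 1) := by
  rw [isLittleO_iff] at h ⊢
  intro ε hε
  have h1 := h hε
  rw [eventually_nhdsWithin_iff, Metric.eventually_nhds_iff] at h1 ⊢
  obtain ⟨δ, hδ, hd⟩ := h1
  refine ⟨min δ T, lt_min hδ hT, fun t ht ht0 => ?_⟩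
  have ht0 : 0 ≤ t := ht0
  rw [Real.dist_eq, sub_zero, abs_of_nonneg ht0, lt_min_iff] at ht
  have hsub : Set.Icc 0 t ⊆ Set.Ico 0 T := fun x hx => ⟨hx.1, hx.2.trans_lt ht.2⟩
  have := norm_image_sub_le_of_norm_deriv_le_segment' (f := u) (f' := u') (C := ε * t ^ n)
    (fun x hx => (hu x (hsub hx)).mono hsub) (fun x hx => by
      have := hd (y := x) (by
        rw [Real.dist_eq, sub_zero, abs_of_nonneg hx.1]; linarith [hx.2]) hx.1
      refine this.trans ?_
      rw [norm_pow, Real.norm_of_nonneg hx.1]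
      have h3 := hx.1
      have h4 := hx.2.le
      gcongr) t ⟨ht0, le_rfl⟩
  rw [h0, sub_zero, sub_zero] at this
  rw [norm_pow, Real.norm_of_nonneg ht0]
  calc _ ≤ _ := this
    _ = _ := by ring

/-- If the field `F` agrees with a locally Lipschitz field `P` to order `s - 1` at `0`, then every
solution of `w' = F(w)`, `w(0) = 0` agrees to order `n ≤ s` with the `n`-th Picard iterate of
`P`. -/
theorem isLittleO_sub_picard {F P : V → V} {s : ℕ} {w : ℝ → V} {T : ℝ} {U : ℕ → ℝ → V}
    (hFP : (fun v => F v - P v) =o[𝓝 0] fun v => ‖v‖ ^ (s - 1))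
    {K : NNReal} {N : Set V} (hN : N ∈ 𝓝 0) (hP : LipschitzOnWith K P N)
    (hT : 0 < T) (hw0 : w 0 = 0)
    (hw : ∀ t ∈ Set.Ico 0 T, HasDerivWithinAt w (F (w t)) (Set.Ico 0 T) t)
    (hU0 : U 0 = 0) (hUz : ∀ n, U n 0 = 0)
    (hU : ∀ n t, HasDerivAt (U (n + 1)) (P (U n t)) t) {n : ℕ} (hn : n ≤ s) :
    (fun t => w t - U n t) =o[𝓝[Set.Ici 0] 0] fun t : ℝ => t ^ n := by
  have hnhds : 𝓝[Set.Ico 0 T] (0 : ℝ) = 𝓝[Set.Ici 0] 0 := nhdsWithin_Ico_eq_nhdsGE hT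
  have hw' := hw 0 ⟨le_rfl, hT⟩
  have hwlim : Tendsto w (𝓝[Set.Ici 0] 0) (𝓝 0) := by
    have := hw'.continuousWithinAt.tendsto
    rwa [hnhds, hw0] at this
  have hwO : w =O[𝓝[Set.Ici 0] 0] fun t : ℝ => t := by
    have := hw'.hasFDerivWithinAt.isBigO_sub
    simpa [hnhds, hw0] using this
  induction n with
  | zero =>
    simpa [hU0, isLittleO_one_iff] using hwlim
  | succ n ih =>
    -- Since `w = O(t)`, the field error is `o(t ^ (s - 1))`, hence `o(t ^ n)`. The Lipschitz bound
    -- carries the previous estimate through `P`, and integration gains one order.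
    have hns : n ≤ s - 1 := by omega
    have h1 : (fun t => F (w t) - P (w t)) =o[𝓝[Set.Ici 0] 0] fun t : ℝ => t ^ n := by
      have a := hFP.comp_tendsto hwlim
      refine a.trans_isBigO ?_
      have b : (fun t => ‖w t‖ ^ (s - 1)) =O[𝓝[Set.Ici 0] 0] fun t : ℝ => t ^ (s - 1) :=
        hwO.norm_left.pow _
      refine b.trans ?_
      refine (IsBigO.of_bound 1 ?_ : _ =O[𝓝 (0 : ℝ)] _).mono nhdsWithin_le_nhds
      filter_upwards [Metric.ball_mem_nhds (0 : ℝ) one_pos] with t ht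
      rw [mem_ball_zero_iff] at ht
      rw [one_mul, norm_pow, norm_pow]
      exact pow_le_pow_of_le_one (norm_nonneg t) ht.le hns
    have hUlim : Tendsto (U n) (𝓝[Set.Ici 0] 0) (𝓝 0) := by
      have hc : ContinuousAt (U n) 0 := by
        cases n with
        | zero => rw [hU0]; exact continuousAt_const
        | succ n => exact (hU n 0).continuousAt
      have := hc.tendsto
      rw [hUz] at this
      exact this.mono_left nhdsWithin_le_nhds
    have h2 : (fun t => P (w t) - P (U n t)) =o[𝓝[Set.Ici 0] 0] fun t : ℝ => t ^ n := by
      refine IsBigO.trans_isLittleO ?_ (ih (by omega))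
      refine IsBigO.of_bound K ?_
      filter_upwards [hwlim hN, hUlim hN] with t ht1 ht2
      simpa [dist_eq_norm] using hP.dist_le_mul _ ht1 _ ht2
    refine isLittleO_pow_succ_of_hasDerivWithinAt hT
      (u' := fun t => F (w t) - P (U n t)) (fun t ht =>
        (hw t ht).sub (hU n t).hasDerivWithinAt) (by simp [hw0, hUz]) ?_
    simpa using h1.add h2

end PicardExpansion

end

/-! ### Zero sets of real polynomials are null. -/

section

open MeasureTheory

/-- A nonzero real polynomial does not vanish almost everywhere. -/
theorem MvPolynomial.ae_eval_ne_zero {m : ℕ} {D : MvPolynomial (Fin m) ℝ} {c₀ : Fin m → ℝ}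
    (h : MvPolynomial.eval c₀ D ≠ 0) :
    ∀ᵐ c : Fin m → ℝ ∂volume, MvPolynomial.eval c D ≠ 0 := by
  -- On a line through `c₀` the restriction is a one-variable polynomial, nonzero at `t = 0`, so it
  -- has finitely many roots.
  have line : ∀ v : Fin m → ℝ, ∀ᵐ t : ℝ ∂volume, MvPolynomial.eval (c₀ + t • v) D ≠ 0 := by
    intro v
    set P : Polynomial ℝ := MvPolynomial.aeval
      (fun i => Polynomial.C (c₀ i) + Polynomial.X * Polynomial.C (v i)) D with hP
    have hev : ∀ t, P.eval t = MvPolynomial.eval (c₀ + t • v) D := by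
      intro t
      rw [hP, ← Polynomial.coe_evalRingHom, MvPolynomial.aeval_def, MvPolynomial.eval₂_eq',
        map_sum, MvPolynomial.eval_eq']
      simp [Polynomial.eval_prod, mul_comm t]
    have hP0 : P ≠ 0 := by
      intro h0
      have := hev 0
      rw [h0] at this
      simp at this
      exact h this.symm
    have hfin : ({t | MvPolynomial.eval (c₀ + t • v) D = 0} : Set ℝ).Finite := by
      refine (P.roots.toFinset.finite_toSet).subset fun t ht => ?_
      simpa [hP0, hev] using ht
    simpa [ae_iff] using hfin.measure_zero volume
  have hmeas : MeasurableSet {x : (Fin m → ℝ) × ℝ | MvPolynomial.eval (c₀ + x.2 • x.1) D ≠ 0} := by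
    have hc : Continuous fun x : (Fin m → ℝ) × ℝ => MvPolynomial.eval (c₀ + x.2 • x.1) D :=
      (MvPolynomial.continuous_eval D).comp (by fun_prop)
    exact (isOpen_ne_fun hc continuous_const).measurableSet
  -- Fubini gives one `t ≠ 0` that works for almost every direction `v`; the substitution `v = t⁻¹ •
  -- (c - c₀)` preserves null sets.
  have hswap := (Measure.ae_ae_comm (μ := (volume : Measure (Fin m → ℝ)))
    (ν := (volume : Measure ℝ))
    (p := fun v t => MvPolynomial.eval (c₀ + t • v) D ≠ 0) hmeas).1 (Filter.Eventually.of_forall line)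
  obtain ⟨t, ht, ht0⟩ := (hswap.and (by
    rw [ae_iff]; simp : ∀ᵐ t : ℝ ∂volume, t ≠ 0)).exists
  have hq : Measure.QuasiMeasurePreserving (fun c : Fin m → ℝ => t⁻¹ • (c - c₀)) volume volume := by
    have h1 : Measure.QuasiMeasurePreserving (fun c : Fin m → ℝ => t⁻¹ • c) volume volume :=
      ⟨by fun_prop, by
        rw [Measure.map_addHaar_smul _ (inv_ne_zero ht0)]
        exact Measure.smul_absolutelyContinuous⟩
    exact h1.comp (measurePreserving_sub_right volume c₀).quasiMeasurePreserving
  filter_upwards [hq.ae ht] with c hc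
  simpa [smul_smul, mul_inv_cancel₀ ht0] using hc

end

/-! ### Gaussian integrals of functions with Gaussian growth. -/

section

open MeasureTheory ProbabilityTheory Filter Topology Metric Asymptotics

section GaussianField

/-- Combines `y ^ k ≤ k! * exp y` with `x ≤ b * x ^ 2 + 1 / (4 * b)`, a completed square. -/
theorem one_add_pow_le_exp_sq {b : ℝ} (hb : 0 < b) (k : ℕ) :
    ∃ K > 0, ∀ x : ℝ, 0 ≤ x → (1 + x) ^ k ≤ K * Real.exp (b * x ^ 2) := by
  refine ⟨k.factorial * Real.exp (1 + 1 / (4 * b)), by positivity, fun x hx => ?_⟩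
  have h1 := Real.pow_div_factorial_le_exp (x := 1 + x) (by positivity) k
  rw [div_le_iff₀ (by positivity)] at h1
  have h2 : 1 + x ≤ (1 + 1 / (4 * b)) + b * x ^ 2 := by
    have h3 : b * x ^ 2 + 1 / (4 * b) - x = b * (x - 1 / (2 * b)) ^ 2 := by field_simp; ring
    nlinarith [mul_nonneg hb.le (sq_nonneg (x - 1 / (2 * b)))]
  calc (1 + x) ^ k ≤ Real.exp (1 + x) * k.factorial := h1
    _ ≤ Real.exp ((1 + 1 / (4 * b)) + b * x ^ 2) * k.factorial := by gcongr
    _ = _ := by rw [Real.exp_add]; ring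

/-- Polynomials have at most Gaussian growth. -/
theorem Polynomial.exists_abs_eval_le_exp_sq (Q : Polynomial ℝ) :
    ∃ C, 0 ≤ C ∧ ∀ x : ℝ, |Q.eval x| ≤ C * Real.exp (C * x ^ 2) := by
  induction Q using Polynomial.induction_on' with
  | add P Q hP hQ =>
    obtain ⟨A, hA, hA'⟩ := hP
    obtain ⟨B, hB, hB'⟩ := hQ
    refine ⟨A + B, by positivity, fun x => ?_⟩
    rw [Polynomial.eval_add]
    calc |P.eval x + Q.eval x| ≤ A * Real.exp (A * x ^ 2) + B * Real.exp (B * x ^ 2) :=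
          (abs_add_le _ _).trans (add_le_add (hA' x) (hB' x))
      _ ≤ A * Real.exp ((A + B) * x ^ 2) + B * Real.exp ((A + B) * x ^ 2) := by
          gcongr <;> linarith
      _ = _ := by ring
  | monomial n a =>
    obtain ⟨K, hK, hK'⟩ := one_add_pow_le_exp_sq one_pos n
    refine ⟨|a| * K + 1, by positivity, fun x => ?_⟩
    rw [Polynomial.eval_monomial, abs_mul, abs_pow]
    calc |a| * |x| ^ n ≤ |a| * (1 + |x|) ^ n := by gcongr; linarith
      _ ≤ |a| * (K * Real.exp (1 * |x| ^ 2)) := by gcongr; exact hK' _ (abs_nonneg x)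
      _ ≤ (|a| * K + 1) * Real.exp (1 * |x| ^ 2) := by
          rw [← mul_assoc]; gcongr; linarith
      _ ≤ _ := by
          rw [sq_abs]
          gcongr
          have : 0 ≤ |a| * K := by positivity
          linarith

/-- Fernique's theorem provides an integrable `exp (a * ‖z‖ ^ 2)`; half of the exponent is kept and
the other half absorbs the power. -/
theorem exists_integrable_pow_mul_exp_sq (V : Type*) [NormedAddCommGroup V]
    [InnerProductSpace ℝ V] [FiniteDimensional ℝ V] [MeasurableSpace V] [BorelSpace V] :
    ∃ b > 0, ∀ k : ℕ,
      Integrable (fun z : V => (1 + ‖z‖) ^ k * Real.exp (b * ‖z‖ ^ 2)) (stdGaussian V) := by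
  obtain ⟨a, ha, hint⟩ := IsGaussian.exists_integrable_exp_sq (stdGaussian V)
  refine ⟨a / 2, by positivity, fun k => ?_⟩
  obtain ⟨K, hK, hK'⟩ := one_add_pow_le_exp_sq (b := a / 2) (by positivity) k
  refine (hint.const_mul K).mono' (by fun_prop) (Eventually.of_forall fun z => ?_)
  rw [Real.norm_of_nonneg (by positivity)]
  calc _ ≤ (K * Real.exp (a / 2 * ‖z‖ ^ 2)) * Real.exp (a / 2 * ‖z‖ ^ 2) := by
        gcongr; exact hK' _ (norm_nonneg z)
    _ = K * Real.exp (a * ‖z‖ ^ 2) := by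
        rw [mul_assoc, ← Real.exp_add]; congr 2; ring

theorem Function.HasTemperateGrowth.exists_norm_le {V F : Type*} [NormedAddCommGroup V]
    [NormedSpace ℝ V] [NormedAddCommGroup F] [NormedSpace ℝ F] {f : V → F}
    (hf : f.HasTemperateGrowth) : ∃ A k, 0 < A ∧ ∀ z, ‖f z‖ ≤ A * (1 + ‖z‖) ^ k := by
  obtain ⟨k, C, h⟩ := hf.2 0
  refine ⟨max C 1, k, by positivity, fun z => ?_⟩
  have := h z
  rw [norm_iteratedFDeriv_zero] at this
  exact this.trans (by gcongr; exact le_max_left _ _)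

/-- Restricting `w` to a small ball makes any Gaussian growth rate `C` integrable, which is why all
estimates on the drift are local at `w = 0`. -/
theorem exp_mul_inner_sq_le {V : Type*} [NormedAddCommGroup V] [InnerProductSpace ℝ V]
    {C b r : ℝ} (hC : 0 ≤ C) (hr : C * r ^ 2 ≤ b) {w z : V}
    (hw : ‖w‖ ≤ r) : Real.exp (C * ⟪w, z⟫ ^ 2) ≤ Real.exp (b * ‖z‖ ^ 2) := by
  rw [Real.exp_le_exp]
  calc C * ⟪w, z⟫ ^ 2 ≤ C * (‖w‖ * ‖z‖) ^ 2 := by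
        gcongr ?_ * ?_
        exact sq_le_sq' (neg_le_of_abs_le (abs_real_inner_le_norm w z)) (real_inner_le_norm w z)
    _ ≤ C * (r * ‖z‖) ^ 2 := by gcongr
    _ = (C * r ^ 2) * ‖z‖ ^ 2 := by ring
    _ ≤ _ := by gcongr

variable {V : Type*} [NormedAddCommGroup V] [InnerProductSpace ℝ V] [FiniteDimensional ℝ V]
  [MeasurableSpace V] [BorelSpace V]

theorem Function.HasTemperateGrowth.integrable_stdGaussian {F : Type*} [NormedAddCommGroup F]
    [NormedSpace ℝ F] {f : V → F} (hf : f.HasTemperateGrowth) :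
    Integrable f (stdGaussian V) := by
  obtain ⟨b, hb, hint⟩ := exists_integrable_pow_mul_exp_sq V
  obtain ⟨A, k, hA, hf'⟩ := hf.exists_norm_le
  refine ((hint k).const_mul A).mono' hf.1.continuous.aestronglyMeasurable
    (Eventually.of_forall fun z => (hf' z).trans ?_)
  gcongr
  exact le_mul_of_one_le_right (by positivity) (Real.one_le_exp (by positivity))

/-- Near `w = 0`, the vector field `w ↦ E[z h(z) g(wᵀ z)]` is well defined and continuous. -/
theorem exists_integrable_and_continuousOn {h : V → ℝ} (hh : h.HasTemperateGrowth) {g : ℝ → ℝ}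
    (hg : Continuous g) {C : ℝ} (hC : 0 ≤ C) (hgC : ∀ x, |g x| ≤ C * Real.exp (C * x ^ 2)) :
    ∃ r > 0,
      (∀ w ∈ closedBall (0 : V) r,
        Integrable (fun z => (h z * g ⟪w, z⟫) • z) (stdGaussian V)) ∧
      ContinuousOn (fun w => ∫ z, (h z * g ⟪w, z⟫) • z ∂stdGaussian V) (closedBall 0 r) := by
  obtain ⟨b, hb, hint⟩ := exists_integrable_pow_mul_exp_sq V
  obtain ⟨A, k, hA, hA'⟩ := hh.exists_norm_le
  have hhc := hh.1.continuous
  obtain ⟨r, hr, hrb⟩ : ∃ r > 0, C * r ^ 2 ≤ b := by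
    -- Adding `1` to `C` covers the case `C = 0`.
    refine ⟨√(b / (C + 1)), by positivity, ?_⟩
    rw [Real.sq_sqrt (by positivity), mul_div_assoc', div_le_iff₀ (by positivity)]
    nlinarith
  have hbound : ∀ w ∈ closedBall (0 : V) r, ∀ z : V, ‖(h z * g ⟪w, z⟫) • z‖ ≤
      (A * C) * ((1 + ‖z‖) ^ (k + 1) * Real.exp (b * ‖z‖ ^ 2)) := by
    intro w hw z
    rw [mem_closedBall_zero_iff] at hw
    rw [norm_smul, norm_mul, Real.norm_eq_abs, Real.norm_eq_abs]
    calc |h z| * |g ⟪w, z⟫| * ‖z‖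
        ≤ (A * (1 + ‖z‖) ^ k) * (C * Real.exp (b * ‖z‖ ^ 2)) * (1 + ‖z‖) := by
          gcongr
          · exact hA' z
          · exact (hgC _).trans (by gcongr C * ?_; exact exp_mul_inner_sq_le hC hrb hw)
          · linarith
      _ = _ := by ring
  refine ⟨r, hr, fun w hw => ?_, ?_⟩
  · exact ((hint (k + 1)).const_mul (A * C)).mono'
      (by fun_prop) (Eventually.of_forall (hbound w hw))
  · refine continuousOn_of_dominated (bound := fun z =>
      (A * C) * ((1 + ‖z‖) ^ (k + 1) * Real.exp (b * ‖z‖ ^ 2))) (fun w _ => by fun_prop)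
      (fun w hw => Eventually.of_forall (hbound w hw)) ((hint (k + 1)).const_mul _)
      (Eventually.of_forall fun z => by fun_prop)

/-- If `g` has Gaussian growth and vanishes to order more than `n` at `0`, then so does the field
`w ↦ E[z h(z) g(wᵀ z)]`. -/
theorem isLittleO_integral_of_isLittleO {h : V → ℝ} (hh : h.HasTemperateGrowth) {g : ℝ → ℝ}
    {C : ℝ} (hC : 0 ≤ C) (hgC : ∀ x, |g x| ≤ C * Real.exp (C * x ^ 2)) {n : ℕ}
    (hgn : g =o[𝓝 0] fun x : ℝ => x ^ n) :
    (fun w : V => ∫ z, (h z * g ⟪w, z⟫) • z ∂stdGaussian V) =o[𝓝 0] fun w => ‖w‖ ^ n := by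
  obtain ⟨b, hb, hint⟩ := exists_integrable_pow_mul_exp_sq V
  obtain ⟨A, k, hA, hA'⟩ := hh.exists_norm_le
  obtain ⟨r, hr, hrb⟩ : ∃ r > 0, C * r ^ 2 ≤ b := by
    refine ⟨√(b / (C + 1)), by positivity, ?_⟩
    rw [Real.sq_sqrt (by positivity), mul_div_assoc', div_le_iff₀ (by positivity)]
    nlinarith
  -- The exponent counts `k` factors from `h`, `n` from `|⟪w, z⟫| ^ n`, one from the extra factor
  -- `|⟪w, z⟫|` and one from the vector `z`.
  set G : V → ℝ := fun z => A * ((1 + ‖z‖) ^ (k + n + 2) * Real.exp (b * ‖z‖ ^ 2)) with hG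
  have hGint : Integrable G (stdGaussian V) := (hint _).const_mul _
  set M := ∫ z, G z ∂stdGaussian V with hM
  have hM0 : 0 ≤ M := integral_nonneg fun z => by positivity
  rw [isLittleO_iff]
  intro ε hε
  set ε' := ε / (2 * (M + 1)) with hε'
  have hε'0 : 0 < ε' := by positivity
  obtain ⟨δ, hδ, hgδ⟩ := Metric.eventually_nhds_iff.1 (isLittleO_iff.1 hgn hε'0)
  set K := C / δ ^ (n + 1) with hK
  have hK0 : 0 ≤ K := by positivity
  -- For `|x| < δ` this is the little-o bound. For `|x| ≥ δ` the constant `C` is at most `K * |x| ^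
  -- (n + 1)`, and the additional power of `|x|` becomes a factor `‖w‖` that is small near `0`.
  have hgb : ∀ x, |g x| ≤ (ε' + K * |x|) * |x| ^ n * Real.exp (C * x ^ 2) := by
    intro x
    have hx0 : 0 ≤ |x| := abs_nonneg x
    have he : 1 ≤ Real.exp (C * x ^ 2) := Real.one_le_exp (by positivity)
    rcases lt_or_ge |x| δ with hx | hx
    · have h1 := hgδ (y := x) (by simpa [Real.dist_eq] using hx)
      rw [norm_pow, Real.norm_eq_abs, Real.norm_eq_abs] at h1
      calc |g x| ≤ ε' * |x| ^ n := h1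
        _ ≤ (ε' + K * |x|) * |x| ^ n := by
            gcongr
            exact le_add_of_nonneg_right (by positivity)
        _ ≤ _ := le_mul_of_one_le_right (by positivity) he
    · refine (hgC x).trans ?_
      gcongr
      calc C = K * δ ^ (n + 1) := by rw [hK]; field_simp
        _ ≤ K * |x| ^ (n + 1) := by gcongr
        _ = K * |x| * |x| ^ n := by ring
        _ ≤ _ := by gcongr; linarith
  have hρ : 0 < min r (ε' / (K + 1)) := by positivity
  filter_upwards [ball_mem_nhds (0 : V) hρ] with w hw
  rw [mem_ball_zero_iff, lt_min_iff] at hw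
  have hKw : K * ‖w‖ ≤ ε' := by
    have := (lt_div_iff₀ (by positivity)).1 hw.2
    nlinarith [norm_nonneg w]
  have hpt : ∀ z : V, ‖(h z * g ⟪w, z⟫) • z‖ ≤ (2 * ε' * ‖w‖ ^ n) * G z := by
    intro z
    have hin : |⟪w, z⟫| ≤ ‖w‖ * (1 + ‖z‖) :=
      (abs_real_inner_le_norm w z).trans (by gcongr; linarith)
    rw [norm_smul, norm_mul, Real.norm_eq_abs, Real.norm_eq_abs]
    calc |h z| * |g ⟪w, z⟫| * ‖z‖
        ≤ (A * (1 + ‖z‖) ^ k) * ((ε' + K * (‖w‖ * (1 + ‖z‖))) * (‖w‖ * (1 + ‖z‖)) ^ n *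
            Real.exp (b * ‖z‖ ^ 2)) * (1 + ‖z‖) := by
          gcongr
          · exact hA' z
          · refine (hgb _).trans ?_
            gcongr ?_ * ?_
            · gcongr
            · exact exp_mul_inner_sq_le hC hrb hw.1.le
          · linarith
      _ ≤ (A * (1 + ‖z‖) ^ k) * ((2 * ε' * (1 + ‖z‖)) * (‖w‖ * (1 + ‖z‖)) ^ n *
            Real.exp (b * ‖z‖ ^ 2)) * (1 + ‖z‖) := by
          gcongr
          nlinarith [norm_nonneg z, mul_le_mul_of_nonneg_right hKw (norm_nonneg z)]
      _ = _ := by rw [hG, mul_pow]; ring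
  refine (norm_integral_le_of_norm_le (hGint.const_mul _) (Eventually.of_forall hpt)).trans ?_
  rw [integral_const_mul, norm_pow, norm_norm, ← hM]
  calc 2 * ε' * ‖w‖ ^ n * M = (2 * ε' * M) * ‖w‖ ^ n := by ring
    _ ≤ ε * ‖w‖ ^ n := by
        gcongr
        rw [hε']
        rw [mul_div_assoc', div_mul_eq_mul_div, div_le_iff₀ (by positivity)]
        nlinarith

end GaussianField

end

/-! ### Formal Picard iterates and their leading orders. -/

section

open Polynomial

section FormalPicard

variable {p m : ℕ} {A A' : Type*} [CommRing A] [Algebra ℝ A] [CommRing A'] [Algebra ℝ A']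

/-- The polynomial vector field with monomials `W^β`, `β ∈ B`, whose coefficients are the linear
forms `∑ l, K i l β * c l` in the parameter `c`. -/
def polyField (K : Fin p → Fin m → (Fin p → ℕ) → ℝ) (B : Finset (Fin p → ℕ)) (c : Fin m → A)
    (W : Fin p → A) (i : Fin p) : A :=
  ∑ l, ∑ β ∈ B, K i l β • (c l * ∏ j, W j ^ β j)

theorem map_polyField (φ : A →ₐ[ℝ] A') (K : Fin p → Fin m → (Fin p → ℕ) → ℝ)
    (B : Finset (Fin p → ℕ)) (c : Fin m → A) (W : Fin p → A) (i : Fin p) :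
    φ (polyField K B c W i) = polyField K B (fun l => φ (c l)) (fun j => φ (W j)) i := by
  simp [polyField, map_sum, map_prod]

/-- The antiderivative of a polynomial, without constant term. -/
noncomputable def Polynomial.antideriv (P : A[X]) : A[X] :=
  P.sum fun n a => monomial (n + 1) (((n : ℝ) + 1)⁻¹ • a)

theorem Polynomial.coeff_antideriv_zero (P : A[X]) : P.antideriv.coeff 0 = 0 := by
  simp [antideriv, Polynomial.sum, coeff_monomial]

theorem Polynomial.coeff_antideriv_succ (P : A[X]) (n : ℕ) :
    P.antideriv.coeff (n + 1) = ((n : ℝ) + 1)⁻¹ • P.coeff n := by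
  simp only [antideriv, Polynomial.sum, finsetSum_coeff, coeff_monomial, add_left_inj]
  rw [Finset.sum_ite_eq' P.support n]
  split_ifs with h
  · rfl
  · rw [notMem_support_iff.1 h, smul_zero]

theorem Polynomial.derivative_antideriv (P : A[X]) : derivative P.antideriv = P := by
  ext n
  rw [coeff_derivative, coeff_antideriv_succ]
  have h : ((n : A) + 1) = algebraMap ℝ A ((n : ℝ) + 1) := by simp
  rw [h, mul_comm, ← Algebra.smul_def, smul_smul, mul_inv_cancel₀ (by positivity), one_smul]

theorem Polynomial.mapAlgHom_antideriv (φ : A →ₐ[ℝ] A') (P : A[X]) :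
    mapAlgHom φ P.antideriv = (mapAlgHom φ P).antideriv := by
  ext n
  cases n with
  | zero => simp [coeff_antideriv_zero]
  | succ n => simp [coeff_antideriv_succ]

/-- The Picard iterates of the initial value problem `W' = polyField K B c W`, `W(0) = 0`. -/
noncomputable def picard (K : Fin p → Fin m → (Fin p → ℕ) → ℝ) (B : Finset (Fin p → ℕ)) (c : Fin m → A) :
    ℕ → Fin p → A[X]
  | 0 => 0
  | n + 1 => fun i => (polyField K B (fun l => C (c l)) (picard K B c n) i).antideriv

variable (K : Fin p → Fin m → (Fin p → ℕ) → ℝ) (B : Finset (Fin p → ℕ))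

theorem mapAlgHom_picard (φ : A →ₐ[ℝ] A') (c : Fin m → A) (n : ℕ) (i : Fin p) :
    mapAlgHom φ (picard K B c n i) = picard K B (fun l => φ (c l)) n i := by
  induction n generalizing i with
  | zero => simp [picard]
  | succ n ih =>
    simp only [picard]
    rw [mapAlgHom_antideriv, map_polyField]
    simp [ih]

theorem picard_coeff_zero (c : Fin m → A) (n : ℕ) (i : Fin p) :
    (picard K B c n i).coeff 0 = 0 := by
  cases n with
  | zero => simp [picard]
  | succ n => exact coeff_antideriv_zero _

theorem hasDerivAt_picard (c : Fin m → ℝ) (n : ℕ) (i : Fin p) (t : ℝ) :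
    HasDerivAt (fun t => (picard K B c (n + 1) i).eval t)
      (polyField K B c (fun j => (picard K B c n j).eval t) i) t := by
  have h := (picard K B c (n + 1) i).hasDerivAt t
  have e : (derivative (picard K B c (n + 1) i)).eval t =
      polyField K B c (fun j => (picard K B c n j).eval t) i := by
    simp only [picard]
    rw [derivative_antideriv, ← coe_aeval_eq_eval, map_polyField]
    simp
  rwa [e] at h

/-- The determinant of the coefficients of orders `2 ^ k`, `k < p`, of the `s`-th Picard iterate,
as a polynomial in the parameter. -/
noncomputable def picardDet (s : ℕ) : MvPolynomial (Fin m) ℝ :=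
  (Matrix.of fun k i : Fin p => (picard K B MvPolynomial.X s i).coeff (2 ^ (k : ℕ))).det

theorem eval_picardDet (s : ℕ) (c : Fin m → ℝ) :
    MvPolynomial.eval c (picardDet K B s) =
      (Matrix.of fun k i : Fin p => (picard K B c s i).coeff (2 ^ (k : ℕ))).det := by
  rw [picardDet, RingHom.map_det]
  congr 1
  ext k i
  have h := mapAlgHom_picard K B (MvPolynomial.aeval c) MvPolynomial.X s i
  simp only [MvPolynomial.aeval_X] at h
  simp [← h, MvPolynomial.coe_aeval_eq_eval]

variable {K B} {c : Fin m → ℝ} {l₀ : Fin p → Fin m}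

/-- After the substitution `W_j = X ^ 2 ^ j * g_j` a monomial `W ^ β` is divisible by `X` to the
weight `∑ 2 ^ j * β j`. A single term has weight `2 ^ i - 1`; the others contribute to `X * R`. -/
theorem polyField_leading {β₀ : Fin p → ℕ} {i : Fin p}
    (hB : β₀ ∈ B) (hβ₀ : ∑ j : Fin p, 2 ^ (j : ℕ) * β₀ j + 1 = 2 ^ (i : ℕ))
    (hord : ∀ l, ∀ β ∈ B, c l ≠ 0 → K i l β ≠ 0 →
      (l = l₀ i ∧ β = β₀) ∨ 2 ^ (i : ℕ) ≤ ∑ j : Fin p, 2 ^ (j : ℕ) * β j)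
    (g : Fin p → ℝ[X]) :
    ∃ R : ℝ[X], polyField K B (fun l => C (c l)) (fun j => X ^ 2 ^ (j : ℕ) * g j) i =
      X ^ (2 ^ (i : ℕ) - 1) * (C (K i (l₀ i) β₀ * c (l₀ i)) * ∏ j, g j ^ β₀ j + X * R) := by
  have hterm : ∀ β : Fin p → ℕ, ∏ j : Fin p, (X ^ 2 ^ (j : ℕ) * g j) ^ β j =
      X ^ (∑ j : Fin p, 2 ^ (j : ℕ) * β j) * ∏ j, g j ^ β j := fun β => by
    simp_rw [mul_pow, Finset.prod_mul_distrib, ← pow_mul, Finset.prod_pow_eq_pow_sum]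
  have hdvd : (X : ℝ[X]) ^ 2 ^ (i : ℕ) ∣ ∑ x ∈ (Finset.univ ×ˢ B).erase (l₀ i, β₀),
      K i x.1 x.2 • (C (c x.1) * ∏ j : Fin p, (X ^ 2 ^ (j : ℕ) * g j) ^ x.2 j) := by
    refine Finset.dvd_sum fun x hx => ?_
    rw [Finset.mem_erase, Finset.mem_product] at hx
    by_cases hc : c x.1 = 0
    · simp [hc]
    by_cases hK : K i x.1 x.2 = 0
    · simp [hK]
    rcases hord x.1 x.2 hx.2.2 hc hK with h | h
    · exact absurd (Prod.ext h.1 h.2) hx.1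
    · rw [hterm, smul_eq_C_mul]
      exact Dvd.dvd.mul_left (Dvd.dvd.mul_left (Dvd.dvd.mul_right (pow_dvd_pow _ h) _) _) _
  obtain ⟨R, hR⟩ := hdvd
  refine ⟨R, ?_⟩
  rw [polyField, ← Finset.sum_product', ← Finset.add_sum_erase _ _
    (show (l₀ i, β₀) ∈ Finset.univ ×ˢ B from Finset.mem_product.2 ⟨Finset.mem_univ _, hB⟩), hR, hterm, smul_eq_C_mul]
  have e : (X : ℝ[X]) ^ 2 ^ (i : ℕ) = X ^ (2 ^ (i : ℕ) - 1) * X := by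
    rw [← pow_succ, ← hβ₀]; rfl
  rw [e, ← hβ₀, map_mul]
  simp only [Nat.add_sub_cancel]
  ring

/-- The identity `1 + 2 + ⋯ + 2 ^ (i - 1) = 2 ^ i - 1` makes the weights `2 ^ j` self-consistent:
integrating `∏_{j < i} W_j` gives order exactly `2 ^ i`. -/
theorem sum_two_pow_mul_indicator (i : Fin p) :
    ∑ j : Fin p, 2 ^ (j : ℕ) * (if j < i then 1 else 0) + 1 = 2 ^ (i : ℕ) := by
  have h : ∑ j : Fin p, 2 ^ (j : ℕ) * (if j < i then 1 else 0) =
      ∑ j ∈ Finset.range i, 2 ^ j := by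
    refine (Fin.sum_univ_eq_sum_range (fun j => 2 ^ j * (if j < (i : ℕ) then 1 else 0)) p).trans ?_
    simp_rw [mul_ite, mul_one, mul_zero]
    rw [← Finset.sum_filter]
    congr 1
    ext j
    simp only [Finset.mem_filter, Finset.mem_range]
    omega
  rw [h]
  have := Nat.geomSum_eq (m := 2) le_rfl i
  have h2 : 0 < 2 ^ (i : ℕ) := by positivity
  simp at this
  omega

/-- The lower bound on the order holds at every iterate. The leading coefficient of component `i`
depends only on those of components `j < i`, so each iteration settles one more component. -/
theorem picard_coeff_triangular
    (hne : ∀ i, c (l₀ i) ≠ 0 ∧ K i (l₀ i) (fun j => if j < i then 1 else 0) ≠ 0)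
    (hB : ∀ i : Fin p, (fun j => if j < i then 1 else 0) ∈ B)
    (hord : ∀ i l, ∀ β ∈ B, c l ≠ 0 → K i l β ≠ 0 →
      (l = l₀ i ∧ β = fun j => if j < i then 1 else 0) ∨
        2 ^ (i : ℕ) ≤ ∑ j : Fin p, 2 ^ (j : ℕ) * β j) (n : ℕ) (i : Fin p) :
    (∀ k < 2 ^ (i : ℕ), (picard K B c n i).coeff k = 0) ∧
      ((i : ℕ) < n → (picard K B c n i).coeff (2 ^ (i : ℕ)) ≠ 0) := by
  induction n generalizing i with
  | zero => simp [picard]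
  | succ n ih =>
    have hg : ∀ j : Fin p, ∃ g, picard K B c n j = X ^ 2 ^ (j : ℕ) * g := fun j =>
      X_pow_dvd_iff.2 (ih j).1
    choose g hg using hg
    have hg0 : ∀ j : Fin p, (j : ℕ) < n → (g j).coeff 0 ≠ 0 := fun j hj => by
      have := (ih j).2 hj
      rw [hg j] at this
      have e := coeff_X_pow_mul (g j) (2 ^ (j : ℕ)) 0
      rw [zero_add] at e
      rwa [e] at this
    obtain ⟨R, hR⟩ := polyField_leading (hB i) (sum_two_pow_mul_indicator i) (hord i) g
    have hfun : picard K B c n = fun j : Fin p => X ^ 2 ^ (j : ℕ) * g j := _root_.funext hg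
    rw [← hfun] at hR
    have h2 : 0 < 2 ^ (i : ℕ) := by positivity
    constructor
    · intro k hk
      cases k with
      | zero => exact picard_coeff_zero _ _ _ _ _
      | succ k =>
        simp only [picard]
        rw [coeff_antideriv_succ, hR, coeff_X_pow_mul', if_neg (by omega), smul_zero]
    · intro hin
      -- The antiderivative shifts degrees by one, so the coefficient wanted is that of the field at
      -- `N = 2 ^ i - 1`.
      obtain ⟨N, hN⟩ : ∃ N, 2 ^ (i : ℕ) = N + 1 := ⟨2 ^ (i : ℕ) - 1, by omega⟩
      simp only [picard]
      rw [hR, hN, coeff_antideriv_succ, Nat.add_sub_cancel]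
      have e := coeff_X_pow_mul (C (K i (l₀ i) (fun j => if j < i then 1 else 0) * c (l₀ i)) *
        ∏ j, g j ^ (if j < i then 1 else 0) + X * R) N 0
      rw [zero_add] at e
      rw [e, coeff_add, coeff_C_mul, coeff_zero_prod]
      simp only [mul_coeff_zero, coeff_X_zero, zero_mul, add_zero]
      refine smul_ne_zero (by positivity) (mul_ne_zero (mul_ne_zero (hne i).2 (hne i).1) ?_)
      rw [Finset.prod_ne_zero_iff]
      intro j _
      split_ifs with hj
      · rw [pow_one]
        exact hg0 j (by have : (j : ℕ) < i := hj; omega)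
      · simp

/-- Column `i` has no entry before order `2 ^ i`, so the matrix is lower triangular; `p ≤ s` ensures
that all diagonal entries are already settled. -/
theorem eval_picardDet_ne_zero
    (hne : ∀ i, c (l₀ i) ≠ 0 ∧ K i (l₀ i) (fun j => if j < i then 1 else 0) ≠ 0)
    (hB : ∀ i : Fin p, (fun j => if j < i then 1 else 0) ∈ B)
    (hord : ∀ i l, ∀ β ∈ B, c l ≠ 0 → K i l β ≠ 0 →
      (l = l₀ i ∧ β = fun j => if j < i then 1 else 0) ∨
        2 ^ (i : ℕ) ≤ ∑ j : Fin p, 2 ^ (j : ℕ) * β j) {s : ℕ} (hs : p ≤ s) :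
    MvPolynomial.eval c (picardDet K B s) ≠ 0 := by
  rw [eval_picardDet, Matrix.det_of_isLowerTriangular]
  · rw [Finset.prod_ne_zero_iff]
    exact fun i _ => (picard_coeff_triangular hne hB hord s i).2 (i.2.trans_le hs)
  · intro k i hki
    exact (picard_coeff_triangular hne hB hord s i).1 _
      (Nat.pow_lt_pow_right (by norm_num) (by simpa using hki))

end FormalPicard

end

/-! ### Gaussian moments and the coefficients of the field. -/

section

open MeasureTheory ProbabilityTheory

section GaussianMoments

variable {p m : ℕ}

theorem Function.HasTemperateGrowth.finsetProd {V ι : Type*} [NormedAddCommGroup V]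
    [NormedSpace ℝ V] {f : ι → V → ℝ} {s : Finset ι} (hf : ∀ i ∈ s, (f i).HasTemperateGrowth) :
    (fun z => ∏ i ∈ s, f i z).HasTemperateGrowth := by
  classical
  induction s using Finset.induction_on with
  | empty => simp
  | insert a s ha ih =>
    simp_rw [Finset.prod_insert ha]
    exact (hf a (by simp)).mul (ih fun i hi => hf i (by simp [hi]))

theorem EuclideanSpace.hasTemperateGrowth_apply (j : Fin p) :
    (fun z : EuclideanSpace ℝ (Fin p) => z j).HasTemperateGrowth :=
  (EuclideanSpace.proj (𝕜 := ℝ) j : EuclideanSpace ℝ (Fin p) →L[ℝ] ℝ).hasTemperateGrowth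

theorem Polynomial.hasTemperateGrowth_aeval_apply (P : Polynomial ℤ) (j : Fin p) :
    (fun z : EuclideanSpace ℝ (Fin p) => Polynomial.aeval (z j) P).HasTemperateGrowth := by
  simp_rw [Polynomial.aeval_eq_sum_range, zsmul_eq_mul]
  exact Function.HasTemperateGrowth.sum fun n _ =>
    (Function.HasTemperateGrowth.const _).mul
      ((EuclideanSpace.hasTemperateGrowth_apply j).pow n)

theorem SubspaceFlow.hasTemperateGrowth_hermiteSum (α : Fin m → Fin p → ℕ) (c : Fin m → ℝ) :
    (hermiteSum α c).HasTemperateGrowth :=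
  Function.HasTemperateGrowth.sum fun i _ => (Function.HasTemperateGrowth.const (c i)).mul
    (Function.HasTemperateGrowth.finsetProd fun j _ =>
      Polynomial.hasTemperateGrowth_aeval_apply (Polynomial.hermite (α i j)) j)

/-- The Gaussian moments `E[z_i ∏_j He_{a(j)}(z_j) ∏_j z_j ^ β(j)]`. -/
noncomputable def hermiteMoment (a : Fin p → ℕ) (i : Fin p) (β : Fin p → ℕ) : ℝ :=
  ∫ z : EuclideanSpace ℝ (Fin p),
    z i * (∏ j, Polynomial.aeval (z j) (Polynomial.hermite (a j))) * ∏ j, z j ^ β j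
    ∂stdGaussian (EuclideanSpace ℝ (Fin p))

theorem integrable_hermiteMoment (a : Fin p → ℕ) (i : Fin p) (β : Fin p → ℕ) :
    Integrable (fun z : EuclideanSpace ℝ (Fin p) =>
      z i * (∏ j, Polynomial.aeval (z j) (Polynomial.hermite (a j))) * ∏ j, z j ^ β j)
      (stdGaussian (EuclideanSpace ℝ (Fin p))) := by
  refine Function.HasTemperateGrowth.integrable_stdGaussian ?_
  exact ((EuclideanSpace.hasTemperateGrowth_apply i).mul
    (Function.HasTemperateGrowth.finsetProd fun j _ =>
      Polynomial.hasTemperateGrowth_aeval_apply (Polynomial.hermite (a j)) j)).mul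
    (Function.HasTemperateGrowth.finsetProd fun j _ =>
      (EuclideanSpace.hasTemperateGrowth_apply j).pow (β j))

theorem integral_odd_pow_gaussianReal {n : ℕ} (hn : Odd n) :
    ∫ x, x ^ n ∂gaussianReal 0 1 = 0 := by
  have h : ∫ x, x ^ n ∂gaussianReal 0 1 = ∫ x, (-x) ^ n ∂gaussianReal 0 1 := by
    conv_lhs => rw [← neg_zero, ← gaussianReal_map_neg]
    rw [integral_map (by fun_prop) (by fun_prop)]
  simp_rw [hn.neg_pow, integral_neg] at h
  linarith

theorem integral_sq_gaussianReal : ∫ x, x ^ 2 ∂gaussianReal 0 1 = 1 := by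
  have h := variance_fun_id_gaussianReal (μ := 0) (v := 1)
  rw [variance_eq_integral (by fun_prop)] at h
  simpa using h

/-- Only `He_0 = 1` and `He_1 = x` occur, so the integrand is a monomial and the product measure
splits the integral. -/
theorem hermiteMoment_staircase (i k : Fin p) (β : Fin p → ℕ) :
    hermiteMoment (fun j : Fin p => if j ≤ k then 1 else 0) i β =
      ∏ j, ∫ x, x ^ ((if j = i then 1 else 0) + (if j ≤ k then 1 else 0) + β j)
        ∂gaussianReal 0 1 := by
  have hH : ∀ (x : ℝ) (j : Fin p),
      Polynomial.aeval x (Polynomial.hermite (if j ≤ k then 1 else 0)) =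
        x ^ (if j ≤ k then 1 else 0) := fun x j => by
    split_ifs <;> simp
  have hi : ∀ z : Fin p → ℝ, z i = ∏ j, z j ^ (if j = i then 1 else 0) := fun z => by
    simp [pow_ite]
  rw [hermiteMoment, ← map_pi_eq_stdGaussian, integral_map (by fun_prop),
    ← integral_fintype_prod_eq_prod]
  · congr 1
    ext z
    simp only [hH, pow_add, Finset.prod_mul_distrib]
    rw [← hi]
  · have h := integrable_hermiteMoment (fun j : Fin p => if j ≤ k then 1 else 0) i β
    rw [← map_pi_eq_stdGaussian] at h
    exact h.aestronglyMeasurable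

/-- If `k < i` then `β i` is odd, and if `k > i` then `β k` is odd; that one entry already has
weight at least `2 ^ i`. If `k = i`, every `β j` with `j < i` is odd, so `β` dominates the
indicator, of weight `2 ^ i - 1`, and any excess reaches `2 ^ i`. -/
theorem eq_or_two_pow_le_of_even {i k : Fin p} {β : Fin p → ℕ}
    (h : ∀ j, Even ((if j = i then 1 else 0) + (if j ≤ k then 1 else 0) + β j)) :
    (k = i ∧ β = fun j => if j < i then 1 else 0) ∨
      2 ^ (i : ℕ) ≤ ∑ j : Fin p, 2 ^ (j : ℕ) * β j := by
  have hle : ∀ j : Fin p, 1 ≤ β j → i ≤ j → 2 ^ (i : ℕ) ≤ ∑ j : Fin p, 2 ^ (j : ℕ) * β j := by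
    intro j hj hij
    calc 2 ^ (i : ℕ) ≤ 2 ^ (j : ℕ) * β j :=
          (Nat.pow_le_pow_right (by norm_num) hij).trans (Nat.le_mul_of_pos_right _ hj)
      _ ≤ _ := Finset.single_le_sum (f := fun j : Fin p => 2 ^ (j : ℕ) * β j)
          (fun _ _ => Nat.zero_le _) (Finset.mem_univ j)
  rcases lt_trichotomy k i with hk | rfl | hk
  · refine Or.inr (hle i ?_ le_rfl)
    have := h i
    rw [if_pos rfl, if_neg hk.not_ge] at this
    by_contra hb
    rw [show β i = 0 by omega] at this
    simp at this
  · have hge : ∀ j, (if j < k then 1 else 0) ≤ β j := by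
      intro j
      split_ifs with hj
      · have := h j
        rw [if_neg hj.ne, if_pos hj.le] at this
        by_contra hb
        rw [show β j = 0 by omega] at this
        simp at this
      · exact Nat.zero_le _
    by_cases hβ : β = fun j => if j < k then 1 else 0
    · exact Or.inl ⟨rfl, hβ⟩
    · right
      obtain ⟨j, hj⟩ := Function.ne_iff.1 hβ
      have hlt : ∑ j : Fin p, 2 ^ (j : ℕ) * (if j < k then 1 else 0) <
          ∑ j : Fin p, 2 ^ (j : ℕ) * β j :=
        Finset.sum_lt_sum (fun j _ => Nat.mul_le_mul_left _ (hge j))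
          ⟨j, Finset.mem_univ j, Nat.mul_lt_mul_of_pos_left
            (lt_of_le_of_ne (hge j) (Ne.symm hj)) (by positivity)⟩
      have := sum_two_pow_mul_indicator k
      omega
  · refine Or.inr (hle k ?_ hk.le)
    have := h k
    rw [if_neg hk.ne', if_pos le_rfl] at this
    by_contra hb
    rw [show β k = 0 by omega] at this
    simp at this

theorem eq_or_two_pow_le_of_hermiteMoment_ne_zero {i k : Fin p} {β : Fin p → ℕ}
    (h : hermiteMoment (fun j : Fin p => if j ≤ k then 1 else 0) i β ≠ 0) :
    (k = i ∧ β = fun j => if j < i then 1 else 0) ∨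
      2 ^ (i : ℕ) ≤ ∑ j : Fin p, 2 ^ (j : ℕ) * β j := by
  refine eq_or_two_pow_le_of_even (k := k) fun j => ?_
  rw [hermiteMoment_staircase, Finset.prod_ne_zero_iff] at h
  by_contra hodd
  exact h j (Finset.mem_univ j) (integral_odd_pow_gaussianReal (Nat.not_even_iff_odd.1 hodd))

/-- Each variable occurs with exponent `2` (for `j ≤ i`) or `0`, so all factors equal `1`. -/
theorem hermiteMoment_staircase_indicator_ne_zero (i : Fin p) :
    hermiteMoment (fun j : Fin p => if j ≤ i then 1 else 0) i
      (fun j => if j < i then 1 else 0) ≠ 0 := by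
  rw [hermiteMoment_staircase, Finset.prod_ne_zero_iff]
  intro j _
  rcases lt_trichotomy j i with h | rfl | h
  · simp [h, h.ne, h.le, integral_sq_gaussianReal]
  · simp [integral_sq_gaussianReal]
  · simp [h.ne', h.not_gt, h.not_ge]

/-- The coefficients of the vector field `w ↦ E[z h(z) ∑ k, b k * (wᵀ z) ^ k]`, for `h` a
combination of Hermite products. -/
noncomputable def hermiteFieldCoeff (α : Fin m → Fin p → ℕ) (b : ℕ → ℝ) (i : Fin p) (l : Fin m)
    (β : Fin p → ℕ) : ℝ :=
  b (∑ j, β j) * Nat.multinomial Finset.univ β * hermiteMoment (α l) i β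

/-- The exponents `β` with `∑ j, β j < s`. -/
def exponents (p s : ℕ) : Finset (Fin p → ℕ) :=
  (Finset.range s).biUnion fun k => Finset.piAntidiag Finset.univ k

theorem mem_exponents {s : ℕ} {β : Fin p → ℕ} : β ∈ exponents p s ↔ ∑ j, β j < s := by
  simp [exponents]

/-- The multinomial expansion of `⟪w, z⟫ ^ k` separates `w` from `z`, which leaves the moments as
coefficients and `c` entering linearly. -/
theorem integral_hermiteSum_mul_sum_pow (α : Fin m → Fin p → ℕ) (c : Fin m → ℝ) (b : ℕ → ℝ)
    (s : ℕ) (w : EuclideanSpace ℝ (Fin p)) :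
    ∫ z, (SubspaceFlow.hermiteSum α c z * ∑ k ∈ Finset.range s, b k * ⟪w, z⟫ ^ k) • z
      ∂stdGaussian (EuclideanSpace ℝ (Fin p)) =
    WithLp.toLp 2 (fun i => polyField (hermiteFieldCoeff α b) (exponents p s) c (fun j => w j) i) := by
  have hint : Integrable
      (fun z => (SubspaceFlow.hermiteSum α c z * ∑ k ∈ Finset.range s, b k * ⟪w, z⟫ ^ k) • z)
      (stdGaussian (EuclideanSpace ℝ (Fin p))) := by
    refine Function.HasTemperateGrowth.integrable_stdGaussian ?_
    refine ((SubspaceFlow.hasTemperateGrowth_hermiteSum α c).mul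
      (Function.HasTemperateGrowth.sum fun k _ =>
        (Function.HasTemperateGrowth.const (b k)).mul
          (Function.HasTemperateGrowth.pow ?_ k))).smul Function.HasTemperateGrowth.id'
    exact (innerSL ℝ w).hasTemperateGrowth
  ext i
  have h1 := (EuclideanSpace.proj (𝕜 := ℝ) i :
    EuclideanSpace ℝ (Fin p) →L[ℝ] ℝ).integral_comp_comm hint
  refine h1.symm.trans ?_
  have h2 : ∀ z : EuclideanSpace ℝ (Fin p), (EuclideanSpace.proj (𝕜 := ℝ) i :
      EuclideanSpace ℝ (Fin p) →L[ℝ] ℝ)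
        ((SubspaceFlow.hermiteSum α c z * ∑ k ∈ Finset.range s, b k * ⟪w, z⟫ ^ k) • z) =
      ∑ l, ∑ β ∈ exponents p s,
        (c l * b (∑ j, β j) * Nat.multinomial Finset.univ β * ∏ j, w j ^ β j) *
          (z i * (∏ j, Polynomial.aeval (z j) (Polynomial.hermite (α l j))) * ∏ j, z j ^ β j) := by
    intro z
    have hsum : ∑ k ∈ Finset.range s, b k * ⟪w, z⟫ ^ k = ∑ β ∈ exponents p s,
        b (∑ j, β j) * Nat.multinomial Finset.univ β * ((∏ j, w j ^ β j) * ∏ j, z j ^ β j) := by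
      rw [exponents, Finset.sum_biUnion]
      · refine Finset.sum_congr rfl fun k _ => ?_
        have hin : ⟪w, z⟫ = ∑ j, w j * z j := by
          simp [PiLp.inner_apply, mul_comm]
        rw [hin, Finset.sum_pow_eq_sum_piAntidiag, Finset.mul_sum]
        refine Finset.sum_congr rfl fun β hβ => ?_
        rw [(Finset.mem_piAntidiag.1 hβ).1]
        simp_rw [mul_pow, Finset.prod_mul_distrib]
        ring
      · intro k _ k' _ hkk'
        rw [Function.onFun, Finset.disjoint_left]
        intro β h h'
        exact hkk' ((Finset.mem_piAntidiag.1 h).1.symm.trans (Finset.mem_piAntidiag.1 h').1)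
    rw [PiLp.proj_apply, PiLp.smul_apply, smul_eq_mul, hsum, SubspaceFlow.hermiteSum,
      Finset.sum_mul_sum, Finset.sum_mul]
    refine Finset.sum_congr rfl fun l _ => ?_
    rw [Finset.sum_mul]
    refine Finset.sum_congr rfl fun β _ => ?_
    ring
  simp_rw [h2]
  rw [integral_finsetSum _ fun l _ => integrable_finsetSum _ fun β _ =>
    (integrable_hermiteMoment (α l) i β).const_mul _]
  simp only [polyField]
  refine Finset.sum_congr rfl fun l _ => ?_
  rw [integral_finsetSum _ fun β _ => (integrable_hermiteMoment (α l) i β).const_mul _]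
  refine Finset.sum_congr rfl fun β _ => ?_
  rw [integral_const_mul, hermiteFieldCoeff, hermiteMoment, smul_eq_mul]
  ring

end GaussianMoments

end

/-! ### Taylor expansion of the flow and genericity in `c`. -/

section

open MeasureTheory ProbabilityTheory Filter Topology Metric Asymptotics

namespace SubspaceFlow

theorem taylorPoly_eq_eval (σ : ℝ → ℝ) (s : ℕ) :
    taylorPoly σ s = fun x => (∑ k ∈ Finset.range (s + 1),
      Polynomial.monomial k (iteratedDeriv k σ 0 / (Nat.factorial k : ℝ))).eval x := by
  funext x
  simp [taylorPoly, Polynomial.eval_finsetSum]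

theorem contDiff_taylorPoly (σ : ℝ → ℝ) (s : ℕ) {n : WithTop ℕ∞} :
    ContDiff ℝ n (taylorPoly σ s) := by
  rw [taylorPoly_eq_eval]
  exact Polynomial.contDiff_aeval (𝕜 := ℝ) _ n

theorem exists_abs_deriv_taylorPoly_le (σ : ℝ → ℝ) (s : ℕ) :
    ∃ C : ℝ, ∀ x : ℝ, |deriv (taylorPoly σ s) x| ≤ C * Real.exp (C * x ^ 2) := by
  rw [taylorPoly_eq_eval]
  simp_rw [Polynomial.deriv]
  obtain ⟨C, -, h⟩ := Polynomial.exists_abs_eval_le_exp_sq _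
  exact ⟨C, h⟩

theorem iteratedDeriv_taylorPoly_zero (σ : ℝ → ℝ) {s k : ℕ} (hk : k ≤ s) :
    iteratedDeriv k (taylorPoly σ s) 0 = iteratedDeriv k σ 0 := by
  have hit : ∀ P : Polynomial ℝ, iteratedDeriv k (fun x => P.eval x) 0 =
      (Polynomial.derivative^[k] P).eval 0 := by
    clear hk
    induction k with
    | zero => simp
    | succ k ih =>
      intro P
      rw [iteratedDeriv_succ', Function.iterate_succ_apply, ← ih]
      congr 1
      funext x
      exact P.deriv
  rw [taylorPoly_eq_eval, hit, ← Polynomial.coeff_zero_eq_eval_zero, Polynomial.coeff_iterate_derivative]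
  simp only [zero_add, Nat.descFactorial_self, Polynomial.finsetSum_coeff,
    Polynomial.coeff_monomial, Finset.sum_ite_eq', Finset.mem_range]
  rw [if_pos (by omega), nsmul_eq_mul]
  field_simp

section Expansion

variable {p : ℕ}

/-- The truncation at order `s` of a curve with polynomial coordinates. -/
theorem isLittleO_eval_sub_polyCurve (W : Fin p → Polynomial ℝ) (s : ℕ) :
    (fun t => WithLp.toLp 2 (fun i => (W i).eval t) -
      polyCurve s (fun j => WithLp.toLp 2 fun i => (W i).coeff j) t :
        ℝ → EuclideanSpace ℝ (Fin p)) =o[𝓝[Set.Ici 0] 0] fun t : ℝ => t ^ s := by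
  have hR : ∀ i, ∃ R : Polynomial ℝ, W i - ∑ j ∈ Finset.range (s + 1),
      Polynomial.monomial j ((W i).coeff j) = Polynomial.X ^ (s + 1) * R := by
    intro i
    refine Polynomial.X_pow_dvd_iff.2 fun d hd => ?_
    simp [Polynomial.coeff_monomial, hd]
  choose R hR using hR
  have e : ∀ t : ℝ, (WithLp.toLp 2 (fun i => (W i).eval t) -
      polyCurve s (fun j => WithLp.toLp 2 fun i => (W i).coeff j) t : EuclideanSpace ℝ (Fin p)) =
      t ^ (s + 1) • WithLp.toLp 2 (fun i => (R i).eval t) := by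
    intro t
    ext i
    have := congrArg (Polynomial.eval t) (hR i)
    simp only [Polynomial.eval_sub, Polynomial.eval_finsetSum, Polynomial.eval_monomial,
      Polynomial.eval_mul, Polynomial.eval_pow, Polynomial.eval_X] at this
    simp only [polyCurve, PiLp.sub_apply, PiLp.smul_apply, smul_eq_mul, ← this, WithLp.ofLp_sum,
      Finset.sum_apply, WithLp.ofLp_smul, Pi.smul_apply, mul_comm (t ^ _)]
  simp_rw [e]
  have h1 : (fun t : ℝ => t ^ (s + 1)) =o[𝓝[Set.Ici 0] 0] fun t : ℝ => t ^ s :=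
    (isLittleO_pow_pow (Nat.lt_succ_self s)).mono nhdsWithin_le_nhds
  have h2 : (fun t => WithLp.toLp 2 (fun i => (R i).eval t) : ℝ → EuclideanSpace ℝ (Fin p))
      =O[𝓝[Set.Ici 0] 0] fun _ => (1 : ℝ) := by
    have hc : Continuous (fun t => WithLp.toLp 2 (fun i => (R i).eval t) :
        ℝ → EuclideanSpace ℝ (Fin p)) :=
      (PiLp.continuous_toLp 2 _).comp (continuous_pi fun i => (R i).continuous)
    exact (hc.tendsto 0).isBigO_one ℝ |>.mono nhdsWithin_le_nhds
  simpa using h1.smul_isBigO h2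

/-- For `v ⟂ S` the polynomial `t ↦ ⟪polyCurve s q t, v⟫` vanishes identically, so every `q j` with
`j ≤ s` is orthogonal to `v`. The `p` of them selected by `e` are independent, hence `v = 0`. -/
theorem eq_top_of_polyCurve_mem {s : ℕ} {q : ℕ → EuclideanSpace ℝ (Fin p)}
    (e : Fin p → ℕ) (he : ∀ k, e k ≤ s) (hdet : (Matrix.of fun k i => q (e k) i).det ≠ 0)
    (S : Submodule ℝ (EuclideanSpace ℝ (Fin p))) (hS : ∀ t : ℝ, polyCurve s q t ∈ S) :
    S = ⊤ := by
  rw [← Submodule.orthogonal_eq_bot_iff, Submodule.eq_bot_iff]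
  intro v hv
  set P : Polynomial ℝ := ∑ j ∈ Finset.range (s + 1), Polynomial.monomial j ⟪q j, v⟫ with hP
  have hP0 : P = 0 := by
    refine Polynomial.funext fun t => ?_
    have := (Submodule.mem_orthogonal S v).1 hv _ (hS t)
    rw [polyCurve, sum_inner] at this
    simp_rw [real_inner_smul_left] at this
    rw [hP, Polynomial.eval_finsetSum, Polynomial.eval_zero, ← this]
    exact Finset.sum_congr rfl fun j _ => by rw [Polynomial.eval_monomial, mul_comm]
  have hq : ∀ j ≤ s, ⟪q j, v⟫ = 0 := by
    intro j hj
    have := congrArg (fun P => Polynomial.coeff P j) hP0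
    simpa [hP, Polynomial.coeff_monomial, Nat.lt_succ_iff, hj] using this
  have hmul : (Matrix.of fun k i => q (e k) i).mulVec v.ofLp = 0 := by
    funext k
    have := hq (e k) (he k)
    rw [PiLp.inner_apply] at this
    simpa [Matrix.mulVec, dotProduct, mul_comm] using this
  ext i
  exact congrFun (Matrix.eq_zero_of_mulVec_eq_zero hdet hmul) i

end Expansion

section Main

variable {p m : ℕ}

theorem contDiff_toLp_polyField (K : Fin p → Fin m → (Fin p → ℕ) → ℝ)
    (B : Finset (Fin p → ℕ)) (c : Fin m → ℝ) {n : WithTop ℕ∞} :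
    ContDiff ℝ n (fun w : EuclideanSpace ℝ (Fin p) =>
      (WithLp.toLp 2 (fun i => polyField K B c (fun j => w j) i) : EuclideanSpace ℝ (Fin p))) := by
  rw [contDiff_euclidean]
  intro i
  simp only [polyField]
  refine ContDiff.sum fun l _ => ContDiff.sum fun β _ => ?_
  refine ContDiff.const_smul _ (ContDiff.mul contDiff_const ?_)
  refine contDiff_prod fun j _ => ?_
  exact (contDiff_euclidean.1 (contDiff_id (𝕜 := ℝ) (E := EuclideanSpace ℝ (Fin p))) j).pow _

variable {σ : ℝ → ℝ} {s : ℕ}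

/-- The coefficients of the Taylor polynomial of `σ'` at `0`. -/
noncomputable def derivTaylorCoeff (σ : ℝ → ℝ) (k : ℕ) : ℝ :=
  iteratedDeriv (k + 1) σ 0 / (Nat.factorial k : ℝ)

theorem isLittleO_deriv_sub_taylor (hs : 0 < s) (hσ : ContDiff ℝ (s : WithTop ℕ∞) σ) :
    (fun x => deriv σ x - ∑ k ∈ Finset.range s, derivTaylorCoeff σ k * x ^ k) =o[𝓝 0]
      fun x : ℝ => x ^ (s - 1) := by
  obtain ⟨n, rfl⟩ : ∃ n, s = n + 1 := ⟨s - 1, by omega⟩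
  have hd : ContDiff ℝ (n : WithTop ℕ∞) (deriv σ) := by
    have : ContDiff ℝ ((n : WithTop ℕ∞) + 1) σ := by exact_mod_cast hσ
    exact (contDiff_succ_iff_deriv.1 this).2.2
  have h := taylor_isLittleO_univ (x₀ := 0) hd
  simp only [taylor_within_apply, sub_zero, iteratedDerivWithin_univ, ← iteratedDeriv_succ',
    smul_eq_mul] at h
  refine h.congr_left fun x => ?_
  congr 1
  refine Finset.sum_congr rfl fun k _ => ?_
  rw [derivTaylorCoeff]
  ring

/-- The Taylor remainder of `σ'` still has Gaussian growth, so `isLittleO_integral_of_isLittleO`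
applies to it; the integral is split only near `0`, where both parts are integrable. -/
theorem isLittleO_drift_sub_polyField (hs : 0 < s) (hσ : ContDiff ℝ (s : WithTop ℕ∞) σ)
    {C : ℝ} (hC : 0 ≤ C) (hgr : ∀ x, |deriv σ x| ≤ C * Real.exp (C * x ^ 2))
    (α : Fin m → Fin p → ℕ) (c : Fin m → ℝ) :
    (fun w => drift σ (hermiteSum α c) w - WithLp.toLp 2 (fun i =>
      polyField (hermiteFieldCoeff α (derivTaylorCoeff σ)) (exponents p s) c (fun j => w j) i))
      =o[𝓝 0] fun w => ‖w‖ ^ (s - 1) := by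
  set Q : Polynomial ℝ :=
    ∑ k ∈ Finset.range s, Polynomial.monomial k (derivTaylorCoeff σ k) with hQ
  have hQe : ∀ x, Q.eval x = ∑ k ∈ Finset.range s, derivTaylorCoeff σ k * x ^ k := fun x => by
    simp [hQ, Polynomial.eval_finsetSum]
  have hσ1 : Continuous (deriv σ) :=
    hσ.continuous_deriv (by exact_mod_cast hs)
  obtain ⟨C', hC', hQC⟩ := Q.exists_abs_eval_le_exp_sq
  have hh := hasTemperateGrowth_hermiteSum α c
  have hgr' : ∀ x, |deriv σ x - Q.eval x| ≤ (C + C') * Real.exp ((C + C') * x ^ 2) := by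
    intro x
    calc |deriv σ x - Q.eval x| ≤ C * Real.exp (C * x ^ 2) + C' * Real.exp (C' * x ^ 2) :=
          (abs_sub _ _).trans (add_le_add (hgr x) (hQC x))
      _ ≤ C * Real.exp ((C + C') * x ^ 2) + C' * Real.exp ((C + C') * x ^ 2) := by
          gcongr <;> linarith
      _ = _ := by ring
  have hlo := isLittleO_integral_of_isLittleO hh (add_nonneg hC hC') hgr' (n := s - 1) (by
    simpa only [hQe] using isLittleO_deriv_sub_taylor hs hσ)
  obtain ⟨r₁, hr₁, hi₁, -⟩ := exists_integrable_and_continuousOn hh hσ1 hC hgr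
  obtain ⟨r₂, hr₂, hi₂, -⟩ := exists_integrable_and_continuousOn hh Q.continuous hC' hQC
  refine hlo.congr' ?_ EventuallyEq.rfl
  filter_upwards [closedBall_mem_nhds (0 : EuclideanSpace ℝ (Fin p)) hr₁,
    closedBall_mem_nhds (0 : EuclideanSpace ℝ (Fin p)) hr₂] with w h1 h2
  rw [← integral_hermiteSum_mul_sum_pow]
  simp_rw [← hQe, mul_sub, sub_smul]
  exact integral_sub (hi₁ w h1) (hi₂ w h2)

theorem exists_isFlow (hσ : ContDiff ℝ 1 σ) {C : ℝ} (hC : 0 ≤ C)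
    (hgr : ∀ x, |deriv σ x| ≤ C * Real.exp (C * x ^ 2)) (α : Fin m → Fin p → ℕ)
    (c : Fin m → ℝ) : ∃ T w, IsFlow σ (hermiteSum α c) T w := by
  obtain ⟨r, hr, hint, hcont⟩ := exists_integrable_and_continuousOn
    (hasTemperateGrowth_hermiteSum α c) (hσ.continuous_deriv le_rfl) hC hgr
  obtain ⟨T, hT, w, hw0, hw⟩ := exists_hasDerivWithinAt_of_continuousOn hr hcont
  exact ⟨T, w, hT, hw0, fun t ht => hint _ (hw t ht).1, fun t ht => (hw t ht).2⟩

theorem notTrapped_of_eval_picardDet_ne_zero (hp : 0 < p)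
    (hσ : ContDiff ℝ ((2 ^ (p - 1) : ℕ) : WithTop ℕ∞) σ)
    {C : ℝ} (hC : 0 ≤ C) (hgr : ∀ x, |deriv σ x| ≤ C * Real.exp (C * x ^ 2))
    (α : Fin m → Fin p → ℕ) (c : Fin m → ℝ)
    (hc : MvPolynomial.eval c (picardDet (hermiteFieldCoeff α (derivTaylorCoeff σ))
      (exponents p (2 ^ (p - 1))) (2 ^ (p - 1))) ≠ 0) :
    NotTrapped σ (hermiteSum α c) (2 ^ (p - 1)) := by
  have hs : 0 < 2 ^ (p - 1) := by positivity
  refine ⟨exists_isFlow (hσ.of_le (by exact_mod_cast hs)) hC hgr α c, fun T w hw => ?_⟩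
  set K := hermiteFieldCoeff α (derivTaylorCoeff σ)
  set B := exponents p (2 ^ (p - 1))
  refine ⟨fun j => WithLp.toLp 2 fun i => (picard K B c (2 ^ (p - 1)) i).coeff j, ?_,
    fun S hS => ?_⟩
  · obtain ⟨L, N, hN, hL⟩ := (contDiff_toLp_polyField K B c (n := 1)).contDiffAt
      (x := (0 : EuclideanSpace ℝ (Fin p))) |>.exists_lipschitzOnWith
    have h1 := isLittleO_sub_picard
      (U := fun n t => WithLp.toLp 2 fun i => (picard K B c n i).eval t)
      (isLittleO_drift_sub_polyField hs hσ hC hgr α c) hN hL hw.pos hw.init hw.deriv_eq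
      (by funext t; ext i; simp [picard])
      (fun n => by
        ext i
        simp [← Polynomial.coeff_zero_eq_eval_zero, picard_coeff_zero])
      (fun n t => by
        exact ((PiLp.continuousLinearEquiv 2 ℝ fun _ : Fin p => ℝ).symm :
          (Fin p → ℝ) →L[ℝ] EuclideanSpace ℝ (Fin p)).hasFDerivAt.comp_hasDerivAt t
            (hasDerivAt_pi.2 fun i => hasDerivAt_picard K B c n i t)) le_rfl
    have h2 := isLittleO_eval_sub_polyCurve (picard K B c (2 ^ (p - 1))) (2 ^ (p - 1))
    refine (h1.add h2).congr_left fun t => ?_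
    abel
  -- The largest order needed is `2 ^ (p - 1)`, which is exactly `s`.
  · refine eq_top_of_polyCurve_mem (fun k => 2 ^ (k : ℕ))
      (fun k => Nat.pow_le_pow_right (by norm_num) (by omega)) ?_ S hS
    rwa [eval_picardDet] at hc

theorem ae_notTrapped (hp : 0 < p) (α : Fin m → Fin p → ℕ)
    (hstair : ∀ k : Fin p, (fun j : Fin p => if j ≤ k then 1 else 0) ∈ Set.range α)
    (hσ : ContDiff ℝ ((2 ^ (p - 1) : ℕ) : WithTop ℕ∞) σ)
    (hne : ∀ k : ℕ, 1 ≤ k → k ≤ p → iteratedDeriv k σ 0 ≠ 0)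
    (hgr : ∃ C : ℝ, ∀ x : ℝ, |deriv σ x| ≤ C * Real.exp (C * x ^ 2)) :
    ∀ᵐ c : Fin m → ℝ ∂volume, NotTrapped σ (hermiteSum α c) (2 ^ (p - 1)) := by
  obtain ⟨C, hC⟩ := hgr
  have hC0 : 0 ≤ C := by
    have := (abs_nonneg _).trans (hC 0)
    simpa using this
  choose l₀ hl₀ using hstair
  have hps : p ≤ 2 ^ (p - 1) := by
    have := Nat.lt_two_pow_self (n := p - 1)
    omega
  have hcard : ∀ i : Fin p, (∑ j : Fin p, if j < i then 1 else 0) = (i : ℕ) := fun i => by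
    rw [Finset.sum_boole, Nat.cast_id, Finset.filter_gt_eq_Iio, Fin.card_Iio]
  -- The test parameter is `1` on the staircase indices and `0` elsewhere, so no moment of any other
  -- `α l` matters.
  have hdet : MvPolynomial.eval (fun l => if l ∈ Set.range l₀ then 1 else 0)
      (picardDet (hermiteFieldCoeff α (derivTaylorCoeff σ)) (exponents p (2 ^ (p - 1)))
        (2 ^ (p - 1))) ≠ 0 := by
    classical
    refine eval_picardDet_ne_zero (l₀ := l₀) (fun i => ⟨by simp, ?_⟩) (fun i => ?_)
      (fun i l β _ hcl hK => ?_) hps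
    · rw [hermiteFieldCoeff, hl₀ i]
      refine mul_ne_zero (mul_ne_zero ?_ ?_) (hermiteMoment_staircase_indicator_ne_zero i)
      -- The leading exponent has degree `i`, so the coefficient is `σ^{(i+1)}(0) / i!` with `1 ≤ i
      -- + 1 ≤ p`.
      · rw [hcard, derivTaylorCoeff]
        exact div_ne_zero (hne _ (by omega) (by omega)) (by positivity)
      · exact_mod_cast (Nat.multinomial_pos _ _).ne'
    · rw [mem_exponents, hcard]
      omega
    · obtain ⟨k, rfl⟩ : l ∈ Set.range l₀ := by
        by_contra h
        exact hcl (if_neg h)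
      rw [hermiteFieldCoeff, hl₀ k] at hK
      rcases eq_or_two_pow_le_of_hermiteMoment_ne_zero (right_ne_zero_of_mul hK) with h | h
      · exact Or.inl ⟨congrArg l₀ h.1, h.2⟩
      · exact Or.inr h
  filter_upwards [MvPolynomial.ae_eval_ne_zero hdet] with c hc
  exact notTrapped_of_eval_picardDet_ne_zero hp hσ hC0 hC α c hc

end Main

end SubspaceFlow

end

theorem propositionD1 (p m : ℕ) (hp : 0 < p) (α : Fin m → Fin p → ℕ)
    (hα : Function.Injective α)
    (hstair : ∀ k : Fin p, (fun j : Fin p => if j ≤ k then 1 else 0) ∈ Set.range α)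
    (σ : ℝ → ℝ) (hσ : ContDiff ℝ ((2 ^ (p - 1) : ℕ) : WithTop ℕ∞) σ)
    (hne : ∀ k : ℕ, 1 ≤ k → k ≤ p → iteratedDeriv k σ 0 ≠ 0) :
    (∀ᵐ c : Fin m → ℝ ∂MeasureTheory.volume,
      SubspaceFlow.NotTrapped (SubspaceFlow.taylorPoly σ (2 ^ (p - 1)))
        (SubspaceFlow.hermiteSum α c) (2 ^ (p - 1))) ∧
    ((∃ C : ℝ, ∀ x : ℝ, |deriv σ x| ≤ C * Real.exp (C * x ^ 2)) →
      ∀ᵐ c : Fin m → ℝ ∂MeasureTheory.volume,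
        SubspaceFlow.NotTrapped σ (SubspaceFlow.hermiteSum α c) (2 ^ (p - 1))) := by
  have hps : p ≤ 2 ^ (p - 1) := by
    have := Nat.lt_two_pow_self (n := p - 1)
    omega
  refine ⟨?_, SubspaceFlow.ae_notTrapped hp α hstair hσ hne⟩
  -- The Taylor polynomial satisfies the hypotheses of the second claim: it is smooth, has Gaussian
  -- growth, and shares with `σ` the derivatives at `0` up to order `p ≤ s`.
  refine SubspaceFlow.ae_notTrapped hp α hstair (SubspaceFlow.contDiff_taylorPoly σ _)
    (fun k hk1 hkp => ?_) (SubspaceFlow.exists_abs_deriv_taylorPoly_le σ _)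
  rw [SubspaceFlow.iteratedDeriv_taylorPoly_zero σ (hkp.trans hps)]
  exact hne k hk1 hkp
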